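/- Consider $n\ge 3$ anonymous, oblivious robots, viewed as points of $\mathbb{R}^2$, that all run the same deterministic algorithm. Each robot carries a light which shows one of two colors and is persistent. Each robot has a private coordinate system whose origin is its current position; the units of length and the directions of the axes of different robots are unrelated, but all coordinate systems have the same handedness (chirality). Time is divided into rounds (SSYNC). In each round an adversarial scheduler activates a set of robots, and every robot is activated infinitely often (fairness). All robots activated in a round simultaneously do the following, while the other robots do nothing: - Look: the robot obtains, in its own coordinates, the set of all pairs (color, position) of the other robots. So it sees at each point which colors are present on other robots there, but not how many robots there are (set-view); it does not see the color of its own light (external-light); and it does see the other robots that share its own position (local-awareness). - Compute: from this snapshot alone, the algorithm determines a color and a destination, and the robot sets its light to that color. - Move: the robot moves exactly to the destination (rigid movement). Theorem. In this model Gathering is solvable with two colors: there are an initial color and an algorithm, both independent of $n$, such that, for every $n\ge 3$, all arbitrary (not necessarily distinct) initial positions of the $n$ robots, all private coordinate systems with common handedness and every fair scheduler, if all lights initially have the initial color, then after finitely many rounds all robots are at one common point (not fixed in advance), and they stay there forever. -/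

import Mathlib

/-! Robots with visible lights in the plane. The plane `ℝ²` is represented by `ℂ` (with its usual
norm and orientation). Model: external lights, set-view, local-awareness, semi-synchronous rounds,
rigid movement. -/

namespace LuminousRobots

/-- The private coordinate system of a robot: unit of length and direction of the axes (a nonzero
complex number, giving scale and rotation) and handedness (`mirrored`). Together with the position
of the robot, which is always the origin, it is an arbitrary similarity of the plane. -/
structure Frame where
  factor : ℂ
  factor_ne_zero : factor ≠ 0
  mirrored : Bool

/-- Complex conjugation (reflection) if the frame is mirrored, the identity otherwise. -/
noncomputable def Frame.mirror (F : Frame) (z : ℂ) : ℂ :=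
  if F.mirrored then (starRingEnd ℂ) z else z

/-- Coordinates, in the frame `F` of a robot located at `o`, of the point with global
coordinate `z`. -/
noncomputable def Frame.toLocal (F : Frame) (o z : ℂ) : ℂ :=
  F.factor * F.mirror (z - o)

/-- Global coordinate of the point that has coordinate `w` in the frame `F` of a robot
located at `o`. -/
noncomputable def Frame.toGlobal (F : Frame) (o w : ℂ) : ℂ :=
  o + F.mirror (w / F.factor)

theorem Frame.toGlobal_toLocal (F : Frame) (o z : ℂ) : F.toGlobal o (F.toLocal o z) = z := by
  have h := F.factor_ne_zero
  cases hm : F.mirrored <;> simp [Frame.toGlobal, Frame.toLocal, Frame.mirror, hm, h]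

theorem Frame.toLocal_toGlobal (F : Frame) (o w : ℂ) : F.toLocal o (F.toGlobal o w) = w := by
  have h := F.factor_ne_zero
  cases hm : F.mirrored <;>
    simp [Frame.toGlobal, Frame.toLocal, Frame.mirror, hm, h, mul_div_cancel₀]

/-- Agreement on chirality: all frames have the same handedness. Scales and directions of the axes
remain unrelated, and the common handedness need not be the one of the global coordinates. -/
def AgreeOnChirality {n : ℕ} (frame : Fin n → Frame) : Prop :=
  ∀ i j, (frame i).mirrored = (frame j).mirrored

/-- The color of the light and the (global) position of each of the `n` robots. -/
structure Config (L : Type) (n : ℕ) where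
  light : Fin n → L
  pos : Fin n → ℂ

/-- What a robot obtains in `Look`: a set of pairs (color, position in its own coordinates). -/
abbrev Snapshot (L : Type) := Set (L × ℂ)

/-- The snapshot of robot `i`. External light: only the other robots contribute colors.
Set-view: at each point only the set of colors is seen, no multiplicities.
Local-awareness: the other robots located at the position of `i` are seen too (at the origin). -/
def snapshot {L : Type} {n : ℕ} (frame : Fin n → Frame) (C : Config L n) (i : Fin n) :
    Snapshot L :=
  {s | ∃ j, j ≠ i ∧ s = (C.light j, (frame i).toLocal (C.pos i) (C.pos j))}

/-- A deterministic algorithm, common to all robots, which are oblivious and anonymous: the snapshot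
alone determines the new color of the light and the destination (in own coordinates).
In particular neither the own color nor the number of robots is an argument. -/
abbrev Algorithm (L : Type) := Snapshot L → L × ℂ

/-- One semi-synchronous round: the robots in `active` perform `Look`, `Compute` and `Move`
simultaneously, all on the same configuration, and reach their destinations (rigid movement);
the other robots keep light and position. -/
noncomputable def round {L : Type} {n : ℕ} (alg : Algorithm L) (frame : Fin n → Frame)
    (active : Finset (Fin n)) (C : Config L n) : Config L n where
  light i := if i ∈ active then (alg (snapshot frame C i)).1 else C.light i
  pos i :=
    if i ∈ active then (frame i).toGlobal (C.pos i) (alg (snapshot frame C i)).2 else C.pos i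

/-- The configuration at time `t`, for the start configuration `C₀` and the activation sets
`sched 0, sched 1, …`. -/
noncomputable def execution {L : Type} {n : ℕ} (alg : Algorithm L) (frame : Fin n → Frame)
    (sched : ℕ → Finset (Fin n)) (C₀ : Config L n) : ℕ → Config L n
  | 0 => C₀
  | t + 1 => round alg frame (sched t) (execution alg frame sched C₀ t)

/-- A fair scheduler activates each robot infinitely often. -/
def Fair {n : ℕ} (sched : ℕ → Finset (Fin n)) : Prop :=
  ∀ i t, ∃ t' ≥ t, i ∈ sched t'

/-- After finitely many rounds all robots are at one point, and they stay there. -/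
def Gathers {L : Type} {n : ℕ} (E : ℕ → Config L n) : Prop :=
  ∃ (t : ℕ) (q : ℂ), ∀ t' ≥ t, ∀ i, (E t').pos i = q

end LuminousRobots

namespace LuminousRobots

/-! ### The algorithm -/

/-! While all lights are 0 and the occupied set `P` is neither a pair nor a triple containing its
centroid, `P` alone determines where robots are collected: at the leader, or else at the centroid,
to which only the nearest ring moves. The measure is the number of occupied points off the centroid.
If a round empties no ring point, the centroid stays and fewer robots are off it. If it empties
several, the measure drops. If it empties exactly one, the measure drops or the old centroid becomes
a leader (`hasLeader_of_replace`), and collecting there removes a point.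

The colors settle the two exceptional shapes. From an all-0 pair, robots with company go to the
midpoint and show 1, while a lone robot joins the other point; `n ≥ 3` excludes two lone robots. In
a midpoint triple the ends wait until the midpoint shows only 1 and then join it. Both routes end
gathered or in a split pair, 0 at one point and 1 at the other, where the 1s join the 0s
(`leads_of_split`).

Equivariance of `act` under similarities removes the private frames, and `Leads` turns fairness into
well-founded induction. -/

/-- The centroid of a finite set of points. -/
noncomputable def center (P : Finset ℂ) : ℂ := (∑ p ∈ P, p) / (P.card : ℂ)

open Classical in
/-- The points of `P` that are nearest to the centroid among those different from it. -/
noncomputable def innerRing (P : Finset ℂ) : Finset ℂ :=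
  P.filter fun p => p ≠ center P ∧ ∀ q ∈ P, q ≠ center P → ‖p - center P‖ ≤ ‖q - center P‖

/-- The centroid is not occupied, and a single point is nearest to it. -/
def HasLeader (P : Finset ℂ) : Prop := center P ∉ P ∧ (innerRing P).card = 1

open Classical in
/-- The point at which robots are collected: the leader if there is one, else the centroid. -/
noncomputable def target (P : Finset ℂ) : ℂ :=
  -- The ring is a singleton here; its centroid names its point without a choice.
  if HasLeader P then center (innerRing P) else center P

/-- Robots at `p` are to move to the target. -/
def IsMover (P : Finset ℂ) (p : ℂ) : Prop := HasLeader P ∨ p ∈ innerRing P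

open Classical in
/-- Color and destination of a robot at `o` that sees `S`, where `P` is the set of occupied
points. -/
noncomputable def act (P : Finset ℂ) (S : Snapshot (Fin 2)) (o : ℂ) : Fin 2 × ℂ :=
  if P.card = 2 then
    -- `2 * center P - o` is the other point of the pair. The own color is invisible, so a
    -- companion's 0 serves as a substitute.
    if (0, o) ∈ S then
      if (1, 2 * center P - o) ∈ S then (0, o) else (1, center P)
    else if (0, 2 * center P - o) ∈ S then (0, 2 * center P - o) else (0, o)
  else if P.card = 3 ∧ center P ∈ P then
    if o = center P then (1, o) else if (0, center P) ∈ S then (0, o) else (1, center P)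
  else (0, if IsMover P o then target P else o)

open Classical in
/-- The gathering algorithm. -/
noncomputable def gatherAlg : Algorithm (Fin 2) := fun S =>
  -- The observer is absent from its snapshot and adds its own position, the origin. Actual
  -- snapshots are finite, so the default never occurs.
  if h : S.Finite then act (insert 0 (h.toFinset.image Prod.snd)) S 0 else (0, 0)

/-! ### Equivariance -/

/-- The linear part of the local coordinates of a frame. -/
noncomputable def Frame.linear (F : Frame) : ℂ →ₗ[ℝ] ℂ :=
  if F.mirrored then (LinearMap.mulLeft ℝ F.factor) ∘ₗ Complex.conjAe.toLinearMap
  else LinearMap.mulLeft ℝ F.factor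

theorem Frame.toLocal_eq (F : Frame) (o z : ℂ) : F.toLocal o z = F.linear (z - o) := by
  cases hm : F.mirrored <;> simp [Frame.toLocal, Frame.mirror, Frame.linear, hm]

theorem Frame.norm_linear (F : Frame) (z : ℂ) : ‖F.linear z‖ = ‖F.factor‖ * ‖z‖ := by
  cases hm : F.mirrored <;> simp [Frame.linear, hm]

theorem Frame.toLocal_injective (F : Frame) (o : ℂ) : Function.Injective (F.toLocal o) :=
  Function.LeftInverse.injective (F.toGlobal_toLocal o)

theorem Frame.norm_toLocal_sub (F : Frame) (o z w : ℂ) :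
    ‖F.toLocal o z - F.toLocal o w‖ = ‖F.factor‖ * ‖z - w‖ := by
  rw [F.toLocal_eq, F.toLocal_eq, ← map_sub, F.norm_linear]
  congr 2
  ring

theorem card_mul_center {P : Finset ℂ} (hP : P.Nonempty) :
    (P.card : ℂ) * center P = ∑ p ∈ P, p := by
  have : (P.card : ℂ) ≠ 0 := by exact_mod_cast hP.card_pos.ne'
  rw [center]
  field_simp

theorem center_eq_of_card_mul {P : Finset ℂ} {c : ℂ} (hP : P.Nonempty)
    (h : (P.card : ℂ) * c = ∑ p ∈ P, p) : center P = c := by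
  have : (P.card : ℂ) ≠ 0 := by exact_mod_cast hP.card_pos.ne'
  rw [center, ← h]
  field_simp

section Equivariance

variable (F : Frame) (o : ℂ)

theorem center_image {P : Finset ℂ} (hP : P.Nonempty) :
    center (P.image (F.toLocal o)) = F.toLocal o (center P) := by
  apply center_eq_of_card_mul (hP.image _)
  rw [Finset.card_image_of_injective _ (F.toLocal_injective o),
    Finset.sum_image fun _ _ _ _ h => F.toLocal_injective o h]
  simp only [F.toLocal_eq]
  rw [← map_sum, Finset.sum_sub_distrib, ← card_mul_center hP, ← nsmul_eq_mul, ← map_nsmul]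
  simp only [nsmul_eq_mul, Finset.sum_const]
  congr 1
  ring

theorem innerRing_image {P : Finset ℂ} (hP : P.Nonempty) :
    innerRing (P.image (F.toLocal o)) = (innerRing P).image (F.toLocal o) := by
  have hpos : 0 < ‖F.factor‖ := norm_pos_iff.2 F.factor_ne_zero
  ext x
  simp only [innerRing, Finset.mem_filter, Finset.mem_image, center_image F o hP]
  constructor
  · rintro ⟨⟨p, hp, rfl⟩, hne, hmin⟩
    refine ⟨p, ⟨hp, fun h => hne (by rw [h]), fun q hq hqc => ?_⟩, rfl⟩
    have := hmin _ ⟨q, hq, rfl⟩ fun h => hqc (F.toLocal_injective o h)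
    rw [F.norm_toLocal_sub, F.norm_toLocal_sub] at this
    exact le_of_mul_le_mul_left this hpos
  · rintro ⟨p, ⟨hp, hne, hmin⟩, rfl⟩
    refine ⟨⟨p, hp, rfl⟩, fun h => hne (F.toLocal_injective o h), ?_⟩
    rintro _ ⟨q, hq, rfl⟩ hqc
    rw [F.norm_toLocal_sub, F.norm_toLocal_sub]
    exact mul_le_mul_of_nonneg_left (hmin q hq fun h => hqc (by rw [h])) hpos.le

theorem hasLeader_image {P : Finset ℂ} (hP : P.Nonempty) :
    HasLeader (P.image (F.toLocal o)) ↔ HasLeader P := by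
  rw [HasLeader, HasLeader, center_image F o hP, innerRing_image F o hP,
    Finset.card_image_of_injective _ (F.toLocal_injective o),
    (F.toLocal_injective o).mem_finset_image]

theorem target_image {P : Finset ℂ} (hP : P.Nonempty) :
    target (P.image (F.toLocal o)) = F.toLocal o (target P) := by
  unfold target
  by_cases h : HasLeader P
  · have hr : (innerRing P).Nonempty := Finset.card_pos.1 (by rw [h.2]; exact one_pos)
    rw [if_pos h, if_pos ((hasLeader_image F o hP).2 h), innerRing_image F o hP,
      center_image F o hr]
  · rw [if_neg h, if_neg fun h' => h ((hasLeader_image F o hP).1 h'), center_image F o hP]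

theorem isMover_image {P : Finset ℂ} (hP : P.Nonempty) (p : ℂ) :
    IsMover (P.image (F.toLocal o)) (F.toLocal o p) ↔ IsMover P p := by
  rw [IsMover, IsMover, hasLeader_image F o hP, innerRing_image F o hP,
    (F.toLocal_injective o).mem_finset_image]

theorem toLocal_reflect (c p : ℂ) :
    2 * F.toLocal o c - F.toLocal o p = F.toLocal o (2 * c - p) := by
  simp only [F.toLocal_eq]
  rw [two_mul, ← map_add, ← map_sub]
  congr 1
  ring

/-- `act` uses only centroids, comparisons of distances, point reflections and membership, all
respected by similarities, including orientation-reversing ones. -/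
theorem act_image {P : Finset ℂ} (hP : P.Nonempty) {S T : Snapshot (Fin 2)}
    (hT : ∀ a p, (a, F.toLocal o p) ∈ T ↔ (a, p) ∈ S) (p : ℂ) :
    act (P.image (F.toLocal o)) T (F.toLocal o p) =
      ((act P S p).1, F.toLocal o (act P S p).2) := by
  unfold act
  rw [center_image F o hP, target_image F o hP, toLocal_reflect,
    Finset.card_image_of_injective _ (F.toLocal_injective o),
    propext (isMover_image F o hP p), propext (hT 0 p), propext (hT 0 (center P)),
    propext (hT 0 (2 * center P - p)), propext (hT 1 (2 * center P - p))]
  simp only [(F.toLocal_injective o).mem_finset_image, (F.toLocal_injective o).eq_iff]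
  split_ifs <;> rfl

end Equivariance

/-! ### The dynamics in global coordinates -/

variable {n : ℕ}

/-- The set of occupied points. -/
noncomputable def occ (C : Config (Fin 2) n) : Finset ℂ := Finset.univ.image C.pos

/-- The lights and positions of the robots other than `i`. -/
def view (C : Config (Fin 2) n) (i : Fin n) : Snapshot (Fin 2) :=
  {s | ∃ j, j ≠ i ∧ s = (C.light j, C.pos j)}

/-- Color and destination that robot `i` computes. -/
noncomputable def decision (C : Config (Fin 2) n) (i : Fin n) : Fin 2 × ℂ :=
  act (occ C) (view C i) (C.pos i)

/-- A round of the gathering algorithm. -/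
noncomputable def step (active : Finset (Fin n)) (C : Config (Fin 2) n) : Config (Fin 2) n where
  light i := if i ∈ active then (decision C i).1 else C.light i
  pos i := if i ∈ active then (decision C i).2 else C.pos i

theorem pos_mem_occ (C : Config (Fin 2) n) (i : Fin n) : C.pos i ∈ occ C :=
  Finset.mem_image_of_mem _ (Finset.mem_univ i)

theorem mem_occ {C : Config (Fin 2) n} {p : ℂ} : p ∈ occ C ↔ ∃ i, C.pos i = p := by
  simp [occ]

theorem mem_view {C : Config (Fin 2) n} {i : Fin n} {a : Fin 2} {p : ℂ} :
    (a, p) ∈ view C i ↔ ∃ j, j ≠ i ∧ C.light j = a ∧ C.pos j = p := by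
  simp only [view, Set.mem_ofPred_eq, Prod.mk.injEq]
  exact exists_congr fun j => and_congr_right fun _ => and_congr eq_comm eq_comm

theorem mem_snapshot {frame : Fin n → Frame} {C : Config (Fin 2) n} {i : Fin n} {a : Fin 2}
    {p : ℂ} :
    (a, p) ∈ snapshot frame C i ↔
      ∃ j, j ≠ i ∧ C.light j = a ∧ (frame i).toLocal (C.pos i) (C.pos j) = p := by
  simp only [snapshot, Set.mem_ofPred_eq, Prod.mk.injEq]
  exact exists_congr fun j => and_congr_right fun _ => and_congr eq_comm eq_comm

theorem snapshot_finite (frame : Fin n → Frame) (C : Config (Fin 2) n) (i : Fin n) :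
    (snapshot frame C i).Finite := by
  refine (Set.finite_range fun j =>
    (C.light j, (frame i).toLocal (C.pos i) (C.pos j))).subset ?_
  rintro s ⟨j, -, rfl⟩
  exact ⟨j, rfl⟩

theorem toLocal_self (F : Frame) (o : ℂ) : F.toLocal o o = 0 := by
  rw [F.toLocal_eq, sub_self, map_zero]

theorem gatherAlg_snapshot (frame : Fin n → Frame) (C : Config (Fin 2) n) (i : Fin n) :
    gatherAlg (snapshot frame C i) =
      ((decision C i).1, (frame i).toLocal (C.pos i) (decision C i).2) := by
  have hocc : insert 0 ((snapshot_finite frame C i).toFinset.image Prod.snd) =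
      (occ C).image ((frame i).toLocal (C.pos i)) := by
    ext x
    simp only [Finset.mem_insert, Finset.mem_image, Set.Finite.mem_toFinset, Prod.exists,
      mem_snapshot, exists_eq_right, mem_occ]
    constructor
    · rintro (rfl | ⟨_, j, -, -, rfl⟩)
      · exact ⟨_, ⟨i, rfl⟩, toLocal_self _ _⟩
      · exact ⟨_, ⟨j, rfl⟩, rfl⟩
    · rintro ⟨_, ⟨j, rfl⟩, rfl⟩
      by_cases hj : j = i
      · subst hj
        exact Or.inl (toLocal_self _ _)
      · exact Or.inr ⟨_, j, hj, rfl, rfl⟩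
  rw [gatherAlg, dif_pos (snapshot_finite frame C i), hocc]
  conv_lhs => rw [← toLocal_self (frame i) (C.pos i)]
  refine act_image (frame i) (C.pos i) ⟨_, pos_mem_occ C i⟩ (fun a p => ?_) _
  rw [mem_snapshot, mem_view]
  simp only [((frame i).toLocal_injective (C.pos i)).eq_iff]

theorem round_gatherAlg (frame : Fin n → Frame) (active : Finset (Fin n))
    (C : Config (Fin 2) n) : round gatherAlg frame active C = step active C := by
  simp only [round, step, gatherAlg_snapshot, Frame.toGlobal_toLocal]

theorem step_of_mem {active : Finset (Fin n)} {i : Fin n} (h : i ∈ active)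
    (C : Config (Fin 2) n) :
    (step active C).light i = (decision C i).1 ∧ (step active C).pos i = (decision C i).2 := by
  simp [step, h]

theorem step_of_notMem {active : Finset (Fin n)} {i : Fin n} (h : i ∉ active)
    (C : Config (Fin 2) n) :
    (step active C).light i = C.light i ∧ (step active C).pos i = C.pos i := by
  simp [step, h]

theorem exists_changed {active : Finset (Fin n)} {C : Config (Fin 2) n}
    (h : step active C ≠ C) :
    ∃ i ∈ active, decision C i ≠ (C.light i, C.pos i) := by
  by_contra! hc
  apply h
  obtain ⟨l, p⟩ := C
  simp only [step, Config.mk.injEq]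
  constructor <;> funext i <;> split_ifs with hi
  · rw [hc i hi]
  · rfl
  · rw [hc i hi]
  · rfl

theorem step_ne {active : Finset (Fin n)} {C : Config (Fin 2) n} {i : Fin n} (hi : i ∈ active)
    (h : decision C i ≠ (C.light i, C.pos i)) : step active C ≠ C := by
  intro he
  apply h
  obtain ⟨h1, h2⟩ := step_of_mem hi C
  rw [he] at h1 h2
  exact Prod.ext h1.symm h2.symm

/-! ### Fairness as well-founded induction -/

/-- All robots are at one point, or some robot changes the configuration when activated and
every configuration that can come next leads to gathering. -/
inductive Leads : Config (Fin 2) n → Prop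
  | gathered (C : Config (Fin 2) n) (q : ℂ) (h : ∀ i, C.pos i = q) : Leads C
  | step (C : Config (Fin 2) n) (i : Fin n) (live : decision C i ≠ (C.light i, C.pos i))
      (h : ∀ active, step active C ≠ C → Leads (step active C)) : Leads C

/-- A single occupied point is its own centroid, so its ring is empty and there is no leader: nobody
moves, whatever the lights show. -/
theorem step_pos_of_gathered {C : Config (Fin 2) n} {q : ℂ} (h : ∀ i, C.pos i = q)
    (active : Finset (Fin n)) (i : Fin n) : (step active C).pos i = q := by
  have hocc : occ C = {q} := by
    ext x
    simp only [mem_occ, h, Finset.mem_singleton]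
    exact ⟨fun ⟨_, hx⟩ => hx.symm, fun hx => ⟨i, hx.symm⟩⟩
  have hc : center ({q} : Finset ℂ) = q := by simp [center]
  by_cases hi : i ∈ active
  · rw [(step_of_mem hi C).2]
    simp [decision, act, hocc, h i, IsMover, HasLeader, innerRing, hc]
  · rw [(step_of_notMem hi C).2, h i]

/-- As long as the configuration is unchanged the same robot stays live, and fairness eventually
activates it. -/
theorem gathers_of_leads (frame : Fin n → Frame) {sched : ℕ → Finset (Fin n)}
    (hfair : Fair sched) (C₀ : Config (Fin 2) n) {C : Config (Fin 2) n} (hC : Leads C) :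
    ∀ t, execution gatherAlg frame sched C₀ t = C →
      Gathers (execution gatherAlg frame sched C₀) := by
  induction hC with
  | gathered C q h =>
    intro t ht
    refine ⟨t, q, fun t' ht' => ?_⟩
    induction t', ht' using Nat.le_induction with
    | base => rwa [ht]
    | succ k _ ih =>
      intro i
      rw [execution, round_gatherAlg]
      exact step_pos_of_gathered ih _ i
  | step C i live h ih =>
    intro t ht
    obtain ⟨t', ht', hi⟩ := hfair i t
    by_contra hg
    have hconst : ∀ s, t ≤ s → execution gatherAlg frame sched C₀ s = C := by
      intro s hs
      induction s, hs using Nat.le_induction with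
      | base => exact ht
      | succ k _ ihk =>
        by_contra hne
        rw [execution, round_gatherAlg, ihk] at hne
        refine hg (ih _ hne (k + 1) ?_)
        rw [execution, round_gatherAlg, ihk]
    have h1 := hconst (t' + 1) (by omega)
    rw [execution, round_gatherAlg, hconst t' ht'] at h1
    exact step_ne hi live h1

/-! ### Two points and midpoints -/

theorem fin_two_ne_zero {a : Fin 2} : a ≠ 0 ↔ a = 1 := by omega

theorem center_pair {a b : ℂ} (h : a ≠ b) : center {a, b} = (a + b) / 2 := by
  simp [center, Finset.sum_pair h, Finset.card_pair h]

/-- All robots with color `0` are at `b`, all robots with color `1` are at `m`. -/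
theorem leads_of_split {b m : ℂ} (hbm : b ≠ m) (C : Config (Fin 2) n)
    (h : ∀ i, (C.light i = 0 ∧ C.pos i = b) ∨ (C.light i = 1 ∧ C.pos i = m)) : Leads C := by
  induction hk : (Finset.univ.filter fun i => C.light i = 1).card using Nat.strong_induction_on
    generalizing C with
  | _ k ih =>
  by_cases hm : ∃ i, C.pos i = m
  swap
  · refine .gathered C b fun i => ?_
    rcases h i with h' | h'
    · exact h'.2
    · exact absurd ⟨i, h'.2⟩ hm
  by_cases hb : ∃ i, C.pos i = b
  swap
  · refine .gathered C m fun i => ?_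
    rcases h i with h' | h'
    · exact absurd ⟨i, h'.2⟩ hb
    · exact h'.2
  obtain ⟨i₁, hi₁⟩ := hm
  obtain ⟨i₀, hi₀⟩ := hb
  have hl₁ : C.light i₁ = 1 := by
    rcases h i₁ with h' | h'
    · exact absurd (h'.2.symm.trans hi₁) hbm
    · exact h'.1
  have hl₀ : C.light i₀ = 0 := by
    rcases h i₀ with h' | h'
    · exact h'.1
    · exact absurd (hi₀.symm.trans h'.2) hbm
  have hocc : occ C = {b, m} := by
    ext x
    simp only [mem_occ, Finset.mem_insert, Finset.mem_singleton]
    constructor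
    · rintro ⟨i, rfl⟩
      exact (h i).imp And.right And.right
    · rintro (rfl | rfl)
      exacts [⟨i₀, hi₀⟩, ⟨i₁, hi₁⟩]
  have hb' : 2 * ((b + m) / 2) - b = m := by ring
  have hm' : 2 * ((b + m) / 2) - m = b := by ring
  -- No 0 shows at `m`. So robots at `m` cross to the 0 they see at `b`, and robots at `b` stay:
  -- with company because of the 1 at `m`, alone because no 0 is across.
  have hdec : ∀ i, decision C i = (0, b) := by
    intro i
    rcases h i with ⟨hl, hp⟩ | ⟨hl, hp⟩
    · have h1 : ((1 : Fin 2), m) ∈ view C i :=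
        mem_view.2 ⟨i₁, fun he => hbm (by rw [← hp, ← hi₁, he]), hl₁, hi₁⟩
      have h2 : ((0 : Fin 2), m) ∉ view C i := by
        rw [mem_view]
        rintro ⟨j, -, hlj, hpj⟩
        rcases h j with h' | h'
        · exact hbm (h'.2.symm.trans hpj)
        · rw [h'.1] at hlj
          exact one_ne_zero hlj
      simp [decision, act, hocc, Finset.card_pair hbm, center_pair hbm, hp, hb', h1, h2]
    · have h1 : ((0 : Fin 2), b) ∈ view C i :=
        mem_view.2 ⟨i₀, fun he => hbm (by rw [← hp, ← hi₀, he]), hl₀, hi₀⟩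
      have h2 : ((0 : Fin 2), m) ∉ view C i := by
        rw [mem_view]
        rintro ⟨j, -, hlj, hpj⟩
        rcases h j with h' | h'
        · exact hbm (h'.2.symm.trans hpj)
        · rw [h'.1] at hlj
          exact one_ne_zero hlj
      simp [decision, act, hocc, Finset.card_pair hbm, center_pair hbm, hp, hm', h1, h2]
  refine .step C i₁ (by rw [hdec, hl₁]; simp) fun active hne => ?_
  have hstep : ∀ i, ((step active C).light i = 0 ∧ (step active C).pos i = b) ∨
      (i ∉ active ∧ (step active C).light i = C.light i ∧ (step active C).pos i = C.pos i) := by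
    intro i
    by_cases hi : i ∈ active
    · left
      have := step_of_mem hi C
      rwa [hdec] at this
    · exact Or.inr ⟨hi, step_of_notMem hi C⟩
  refine ih _ ?_ (step active C) (fun i => ?_) rfl
  · rw [← hk]
    obtain ⟨i, hi, hch⟩ := exists_changed hne
    refine Finset.card_lt_card (Finset.ssubset_iff_of_subset ?_ |>.2 ⟨i, ?_, ?_⟩)
    · intro j
      simp only [Finset.mem_filter, Finset.mem_univ, true_and]
      intro hj
      rcases hstep j with h' | h'
      · rw [h'.1] at hj
        exact absurd hj zero_ne_one
      · rwa [h'.2.1] at hj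
    · rw [hdec] at hch
      rcases h i with h' | h'
      · exact absurd (by rw [h'.1, h'.2]) hch
      · simpa using h'.1
    · rcases hstep i with h' | h'
      · simp [h'.1]
      · exact absurd hi h'.1
  · rcases hstep i with h' | h'
    · exact Or.inl h'
    · rw [h'.2.1, h'.2.2]
      exact h i

/-- Three points are occupied, one being the midpoint of the others, and all robots outside
the midpoint have color `0`. -/
theorem leads_of_midpoint (C : Config (Fin 2) n) {c : ℂ} (hcard : (occ C).card = 3)
    (hcen : center (occ C) = c) (hc : c ∈ occ C) (h : ∀ i, C.pos i ≠ c → C.light i = 0) :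
    Leads C := by
  induction hk : (Finset.univ.filter fun i => C.light i = 0).card using Nat.strong_induction_on
    generalizing C with
  | _ k ih =>
  have hdec : ∀ i, C.pos i = c → decision C i = (1, c) := by
    intro i hi
    simp [decision, act, hcard, hcen, hc, hi]
  have hview : ∀ i, C.pos i ≠ c →
      (((0 : Fin 2), c) ∈ view C i ↔ ∃ j, C.light j = 0 ∧ C.pos j = c) := by
    intro i hi
    rw [mem_view]
    exact ⟨fun ⟨j, _, hj⟩ => ⟨j, hj⟩, fun ⟨j, hj⟩ => ⟨j, fun he => hi (he ▸ hj.2), hj⟩⟩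
  -- While a 0 shows at the midpoint, only lights there change. Afterwards every decision is `(1,
  -- c)`. Either way the number of 0s drops.
  by_cases hA : ∃ j, C.light j = 0 ∧ C.pos j = c
  · have hdec' : ∀ i, C.pos i ≠ c → decision C i = (C.light i, C.pos i) := by
      intro i hi
      simp [decision, act, hcard, hcen, hc, hi, hview i hi, h i hi, hA]
    obtain ⟨j, hj, hjc⟩ := hA
    refine .step C j (by rw [hdec j hjc, hj]; simp) fun active hne => ?_
    have hpos : ∀ i, (step active C).pos i = C.pos i := by
      intro i
      by_cases hi : i ∈ active
      · rw [(step_of_mem hi C).2]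
        by_cases hic : C.pos i = c
        · rw [hdec i hic, hic]
        · rw [hdec' i hic]
      · exact (step_of_notMem hi C).2
    have hlight : ∀ i, (step active C).light i = 0 → C.light i = 0 := by
      intro i
      by_cases hi : i ∈ active
      · rw [(step_of_mem hi C).1]
        by_cases hic : C.pos i = c
        · rw [hdec i hic]
          intro h0
          exact absurd h0 one_ne_zero
        · exact fun _ => h i hic
      · rw [(step_of_notMem hi C).1]
        exact id
    have hocc : occ (step active C) = occ C := by
      rw [occ, occ, funext hpos]
    refine ih _ ?_ (step active C) (hocc ▸ hcard) (hocc ▸ hcen) (hocc ▸ hc) (fun i hi => ?_) rfl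
    · rw [← hk]
      obtain ⟨i, hi, hch⟩ := exists_changed hne
      have hic : C.pos i = c := by
        by_contra hic
        exact hch (hdec' i hic)
      refine Finset.card_lt_card (Finset.ssubset_iff_of_subset ?_ |>.2 ⟨i, ?_, ?_⟩)
      · intro j
        simpa using hlight j
      · rw [hdec i hic, hic] at hch
        simp only [Finset.mem_filter, Finset.mem_univ, true_and]
        by_contra h0
        exact hch (by rw [fin_two_ne_zero.1 h0])
      · simp [(step_of_mem hi C).1, hdec i hic]
    · rw [hpos] at hi
      by_cases hia : i ∈ active
      · rw [(step_of_mem hia C).1, hdec' i hi, h i hi]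
      · rw [(step_of_notMem hia C).1, h i hi]
  · have hdec' : ∀ i, decision C i = (1, c) := by
      intro i
      by_cases hi : C.pos i = c
      · exact hdec i hi
      · simp [decision, act, hcard, hcen, hc, hi, hview i hi, hA]
    have hB : ∀ i, C.pos i = c → C.light i = 1 := fun i hi =>
      fin_two_ne_zero.1 fun h0 => hA ⟨i, h0, hi⟩
    obtain ⟨p, hp, hpc⟩ := Finset.exists_mem_ne (by omega : 1 < (occ C).card) c
    obtain ⟨i, rfl⟩ := mem_occ.1 hp
    refine .step C i (by rw [hdec', h i hpc]; simp) fun active hne => ?_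
    have hstep : ∀ i, ((step active C).light i = 1 ∧ (step active C).pos i = c) ∨
        ((step active C).light i = 0 ∧ (step active C).pos i = C.pos i ∧ C.pos i ≠ c ∧
          C.light i = 0) := by
      intro i
      by_cases hi : i ∈ active
      · left
        have := step_of_mem hi C
        rwa [hdec'] at this
      · obtain ⟨h1, h2⟩ := step_of_notMem hi C
        by_cases hic : C.pos i = c
        · exact Or.inl ⟨h1.trans (hB i hic), h2.trans hic⟩
        · exact Or.inr ⟨h1.trans (h i hic), h2, hic, h i hic⟩
    have hsub : occ (step active C) ⊆ occ C := by
      intro x hx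
      obtain ⟨j, rfl⟩ := mem_occ.1 hx
      rcases hstep j with h' | h'
      · rwa [h'.2]
      · rw [h'.2.1]
        exact pos_mem_occ C j
    have hc' : c ∈ occ (step active C) := by
      obtain ⟨j, hj⟩ := mem_occ.1 hc
      rcases hstep j with h' | h'
      · exact mem_occ.2 ⟨j, h'.2⟩
      · exact absurd hj h'.2.2.1
    by_cases heq : occ (step active C) = occ C
    · refine ih _ ?_ (step active C) (heq ▸ hcard) (heq ▸ hcen) (heq ▸ hc) (fun i hi => ?_) rfl
      · rw [← hk]
        obtain ⟨i, hi, hch⟩ := exists_changed hne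
        have hic : C.pos i ≠ c := fun hic => hch (by rw [hdec', hic, hB i hic])
        refine Finset.card_lt_card (Finset.ssubset_iff_of_subset ?_ |>.2 ⟨i, ?_, ?_⟩)
        · intro j
          simp only [Finset.mem_filter, Finset.mem_univ, true_and]
          intro hj
          rcases hstep j with h' | h'
          · rw [h'.1] at hj
            exact absurd hj one_ne_zero
          · exact h'.2.2.2
        · simpa using h i hic
        · simp [(step_of_mem hi C).1, hdec']
      · rcases hstep i with h' | h'
        · exact absurd h'.2 hi
        · exact h'.1
    · have hlt := Finset.card_lt_card (Finset.ssubset_iff_subset_ne.2 ⟨hsub, heq⟩)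
      -- At most one end is still occupied, and it holds all remaining 0s.
      have he : ((occ (step active C)).erase c).card ≤ 1 := by
        rw [Finset.card_erase_of_mem hc']
        omega
      by_cases hall : ∀ i, (step active C).pos i = c
      · exact .gathered _ c hall
      · push Not at hall
        obtain ⟨j, hj⟩ := hall
        refine leads_of_split hj _ fun i => ?_
        rcases hstep i with h' | h'
        · exact Or.inr h'
        · refine Or.inl ⟨h'.1, Finset.card_le_one.1 he _ ?_ _ ?_⟩
          · exact Finset.mem_erase.2 ⟨by rw [h'.2.1]; exact h'.2.2.1, pos_mem_occ _ i⟩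
          · exact Finset.mem_erase.2 ⟨hj, pos_mem_occ _ j⟩

/-- Handles partial rounds from an all-0 pair: an emptied end gives a split, two occupied ends a
midpoint triple. -/
theorem leads_of_three_points {a b : ℂ} (hab : a ≠ b) (C : Config (Fin 2) n)
    (h : ∀ i, (C.light i = 0 ∧ (C.pos i = a ∨ C.pos i = b)) ∨
      (C.light i = 1 ∧ C.pos i = (a + b) / 2))
    (hm : ∃ i, C.pos i = (a + b) / 2) : Leads C := by
  have ha : a ≠ (a + b) / 2 := fun he => hab (by linear_combination 2 * he)
  have hb : b ≠ (a + b) / 2 := fun he => hab (by linear_combination -2 * he)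
  by_cases hA : ∃ i, C.pos i = a
  swap
  · refine leads_of_split hb C fun i => ?_
    rcases h i with ⟨h1, h2 | h2⟩ | h'
    · exact absurd ⟨i, h2⟩ hA
    · exact Or.inl ⟨h1, h2⟩
    · exact Or.inr h'
  by_cases hB : ∃ i, C.pos i = b
  swap
  · refine leads_of_split ha C fun i => ?_
    rcases h i with ⟨h1, h2 | h2⟩ | h'
    · exact Or.inl ⟨h1, h2⟩
    · exact absurd ⟨i, h2⟩ hB
    · exact Or.inr h'
  have hocc : occ C = {a, b, (a + b) / 2} := by
    ext x
    simp only [mem_occ, Finset.mem_insert, Finset.mem_singleton]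
    constructor
    · rintro ⟨i, rfl⟩
      rcases h i with ⟨-, h2 | h2⟩ | h'
      exacts [Or.inl h2, Or.inr (Or.inl h2), Or.inr (Or.inr h'.2)]
    · rintro (rfl | rfl | rfl)
      exacts [hA, hB, hm]
  have hcard : (occ C).card = 3 := by
    rw [hocc]
    exact Finset.card_eq_three.2 ⟨_, _, _, hab, ha, hb, rfl⟩
  refine leads_of_midpoint C hcard (c := (a + b) / 2) ?_ (mem_occ.2 hm) fun i hi => ?_
  · rw [center, hcard, hocc, Finset.sum_insert (by simp [hab, ha]), Finset.sum_pair hb]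
    push_cast
    ring
  · rcases h i with h' | h'
    · exact h'.1
    · exact absurd h'.2 hi

/-- All robots have color `0` and exactly two points are occupied. -/
theorem leads_of_two_points (hn : 3 ≤ n) (C : Config (Fin 2) n) (hcard : (occ C).card = 2)
    (h : ∀ i, C.light i = 0) : Leads C := by
  have hview : ∀ i p, ((0 : Fin 2), p) ∈ view C i ↔ ∃ j, j ≠ i ∧ C.pos j = p := by
    intro i p
    simp [mem_view, h]
  have hview' : ∀ i p, ((1 : Fin 2), p) ∉ view C i := by
    intro i p
    simp [mem_view, h]
  have key : ∀ a b : ℂ, a ≠ b → occ C = {a, b} → ∀ i, C.pos i = a →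
      decision C i = if ∃ j, j ≠ i ∧ C.pos j = a then (1, (a + b) / 2) else (0, b) := by
    intro a b hab hocc i hi
    have hb' : 2 * ((a + b) / 2) - a = b := by ring
    have hb : ∃ j, j ≠ i ∧ C.pos j = b := by
      obtain ⟨j, hj⟩ := mem_occ.1 (by rw [hocc]; simp : b ∈ occ C)
      exact ⟨j, fun he => hab (by rw [← hi, ← hj, he]), hj⟩
    simp only [decision, act, Finset.card_pair hab, if_true, hocc, center_pair hab, hi, hb', hview, hb,
      hview', if_false]
  obtain ⟨a, b, hab, hocc⟩ := Finset.card_eq_two.1 hcard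
  have hpos : ∀ i, C.pos i = a ∨ C.pos i = b := by
    intro i
    have := pos_mem_occ C i
    rwa [hocc, Finset.mem_insert, Finset.mem_singleton] at this
  by_cases hlone : ∃ l, ∀ j, j ≠ l → C.pos j ≠ C.pos l
  · obtain ⟨l, hl⟩ := hlone
    clear hpos
    wlog hla : C.pos l = a generalizing a b
    · refine this b a hab.symm (by rw [hocc, Finset.pair_comm]) ?_
      have := pos_mem_occ C l
      rw [hocc, Finset.mem_insert, Finset.mem_singleton] at this
      exact this.resolve_left hla
    have hpos : ∀ i, i ≠ l → C.pos i = b := by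
      intro i hi
      have := pos_mem_occ C i
      rw [hocc, Finset.mem_insert, Finset.mem_singleton] at this
      exact this.resolve_left fun he => hl i hi (he.trans hla.symm)
    have hdl : decision C l = (0, b) := by
      rw [key a b hab hocc l hla, if_neg]
      rintro ⟨j, hj, hja⟩
      exact hl j hj (hja.trans hla.symm)
    have hdo : ∀ i, i ≠ l → decision C i = (1, (a + b) / 2) := by
      intro i hi
      rw [key b a hab.symm (by rw [hocc, Finset.pair_comm]) i (hpos i hi), if_pos, add_comm]
      -- A third robot exists and stands at `b`, so `i` has company and the two points cannot merely
      -- swap.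
      have : ({l, i} : Finset (Fin n)).card < (Finset.univ : Finset (Fin n)).card := by
        have := Finset.card_le_two (a := l) (b := i)
        rw [Finset.card_univ, Fintype.card_fin]
        omega
      obtain ⟨j, -, hj⟩ := Finset.exists_mem_notMem_of_card_lt_card this
      simp only [Finset.mem_insert, Finset.mem_singleton, not_or] at hj
      exact ⟨j, hj.2, hpos j hj.1⟩
    refine .step C l (by rw [hdl, hla]; simp [hab.symm]) fun active hne => ?_
    -- If `l` moves, `a` is emptied and only 0s at `b` and 1s at the midpoint remain.
    by_cases hla' : l ∈ active
    · refine leads_of_split (b := b) (m := (a + b) / 2)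
        (fun he => hab (by linear_combination -2 * he)) _ fun i => ?_
      by_cases hil : i = l
      · subst hil
        have := step_of_mem hla' C
        rw [hdl] at this
        exact Or.inl this
      by_cases hi : i ∈ active
      · have := step_of_mem hi C
        rw [hdo i hil] at this
        exact Or.inr this
      · have := step_of_notMem hi C
        rw [h, hpos i hil] at this
        exact Or.inl this
    · refine leads_of_three_points hab _ (fun i => ?_) ?_
      · by_cases hi : i ∈ active
        · have := step_of_mem hi C
          rw [hdo i fun he => hla' (he ▸ hi)] at this
          exact Or.inr this
        · have := step_of_notMem hi C
          rw [this.1, this.2, h]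
          by_cases hil : i = l
          · exact Or.inl ⟨rfl, Or.inl (hil ▸ hla)⟩
          · exact Or.inl ⟨rfl, Or.inr (hpos i hil)⟩
      · obtain ⟨i, hi, -⟩ := exists_changed hne
        have := step_of_mem hi C
        rw [hdo i fun he => hla' (he ▸ hi)] at this
        exact ⟨i, this.2⟩
  · push Not at hlone
    have hdec : ∀ i, decision C i = (1, (a + b) / 2) := by
      intro i
      rcases hpos i with hi | hi
      · rw [key a b hab hocc i hi, if_pos (hi ▸ hlone i)]
      · rw [key b a hab.symm (by rw [hocc, Finset.pair_comm]) i hi, if_pos (hi ▸ hlone i),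
          add_comm]
    refine .step C ⟨0, by omega⟩ (by rw [hdec, h]; simp) fun active hne => ?_
    refine leads_of_three_points hab _ (fun i => ?_) ?_
    · by_cases hi : i ∈ active
      · have := step_of_mem hi C
        rw [hdec] at this
        exact Or.inr this
      · have := step_of_notMem hi C
        rw [this.1, this.2, h]
        exact Or.inl ⟨rfl, hpos i⟩
    · obtain ⟨i, hi, -⟩ := exists_changed hne
      have := step_of_mem hi C
      rw [hdec] at this
      exact ⟨i, this.2⟩

/-! ### Collecting the robots while all lights show the initial color -/

theorem decision_of_collecting {C : Config (Fin 2) n} (h2 : (occ C).card ≠ 2)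
    (h3 : ¬((occ C).card = 3 ∧ center (occ C) ∈ occ C)) (i : Fin n) :
    (decision C i).1 = 0 ∧ (IsMover (occ C) (C.pos i) → (decision C i).2 = target (occ C)) ∧
      (¬IsMover (occ C) (C.pos i) → (decision C i).2 = C.pos i) := by
  simp only [decision, act, if_neg h2, if_neg h3, true_and]
  exact ⟨fun h => if_pos h, fun h => if_neg h⟩

theorem step_light_of_collecting {C : Config (Fin 2) n} (h : ∀ i, C.light i = 0)
    (h2 : (occ C).card ≠ 2) (h3 : ¬((occ C).card = 3 ∧ center (occ C) ∈ occ C))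
    (active : Finset (Fin n)) (i : Fin n) : (step active C).light i = 0 := by
  by_cases hi : i ∈ active
  · rw [(step_of_mem hi C).1, (decision_of_collecting h2 h3 i).1]
  · rw [(step_of_notMem hi C).1, h]

/-- In a round of collecting, each robot stays or moves to the target. -/
theorem step_pos_of_collecting {C : Config (Fin 2) n}
    (h2 : (occ C).card ≠ 2) (h3 : ¬((occ C).card = 3 ∧ center (occ C) ∈ occ C))
    (active : Finset (Fin n)) (i : Fin n) :
    (step active C).pos i = C.pos i ∨
      IsMover (occ C) (C.pos i) ∧ (step active C).pos i = target (occ C) := by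
  by_cases hi : i ∈ active
  · rw [(step_of_mem hi C).2]
    by_cases hm : IsMover (occ C) (C.pos i)
    · exact Or.inr ⟨hm, (decision_of_collecting h2 h3 i).2.1 hm⟩
    · exact Or.inl ((decision_of_collecting h2 h3 i).2.2 hm)
  · exact Or.inl (step_of_notMem hi C).2

theorem exists_collected {C : Config (Fin 2) n} (h : ∀ i, C.light i = 0)
    (h2 : (occ C).card ≠ 2) (h3 : ¬((occ C).card = 3 ∧ center (occ C) ∈ occ C))
    {active : Finset (Fin n)} (hne : step active C ≠ C) :
    ∃ i, C.pos i ≠ target (occ C) ∧ (step active C).pos i = target (occ C) := by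
  obtain ⟨i, hi, hch⟩ := exists_changed hne
  have hd := decision_of_collecting h2 h3 i
  have hm : IsMover (occ C) (C.pos i) := by
    by_contra hm
    exact hch (Prod.ext (hd.1.trans (h i).symm) (hd.2.2 hm))
  refine ⟨i, fun he => hch (Prod.ext (hd.1.trans (h i).symm) ?_), ?_⟩
  · rw [hd.2.1 hm, he]
  · rw [(step_of_mem hi C).2, hd.2.1 hm]

/-- Lights stay 0 and all moves end at the target, so any change is a new arrival there. -/
theorem card_off_target_lt {C : Config (Fin 2) n} (h : ∀ i, C.light i = 0)
    (h2 : (occ C).card ≠ 2) (h3 : ¬((occ C).card = 3 ∧ center (occ C) ∈ occ C))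
    {active : Finset (Fin n)} (hne : step active C ≠ C) :
    (Finset.univ.filter fun i => (step active C).pos i ≠ target (occ C)).card <
      (Finset.univ.filter fun i => C.pos i ≠ target (occ C)).card := by
  obtain ⟨i, hi, hi'⟩ := exists_collected h h2 h3 hne
  refine Finset.card_lt_card (Finset.ssubset_iff_of_subset ?_ |>.2 ⟨i, ?_, ?_⟩)
  · intro j
    simp only [Finset.mem_filter, Finset.mem_univ, true_and]
    intro hj
    rcases step_pos_of_collecting h2 h3 active j with h' | h'
    · rwa [h'] at hj
    · exact absurd h'.2 hj
  · simpa using hi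
  · simpa using hi'

theorem live_of_mover {C : Config (Fin 2) n}
    (h2 : (occ C).card ≠ 2) (h3 : ¬((occ C).card = 3 ∧ center (occ C) ∈ occ C)) {i : Fin n}
    (hm : IsMover (occ C) (C.pos i)) (hne : C.pos i ≠ target (occ C)) :
    decision C i ≠ (C.light i, C.pos i) := by
  intro he
  have := (decision_of_collecting h2 h3 i).2.1 hm
  rw [he] at this
  exact hne this

/-! ### Collecting at a leader -/

theorem target_mem_of_hasLeader {P : Finset ℂ} (h : HasLeader P) : target P ∈ P := by
  obtain ⟨u, hu⟩ := Finset.card_eq_one.1 h.2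
  rw [target, if_pos h, hu]
  have : u ∈ innerRing P := by rw [hu]; exact Finset.mem_singleton_self u
  simpa [center] using (Finset.mem_filter.1 this).1

/-- The target is occupied, so no point is ever added. While the occupied set persists so does the
leader, and robots off it become fewer; any other change loses a point and is left to `H`. -/
theorem leads_of_hasLeader (hn : 3 ≤ n) (C : Config (Fin 2) n) (h : ∀ i, C.light i = 0)
    (hl : HasLeader (occ C))
    (H : ∀ C' : Config (Fin 2) n, (∀ i, C'.light i = 0) → (occ C').card < (occ C).card →
      Leads C') : Leads C := by
  by_cases h2 : (occ C).card = 2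
  · exact leads_of_two_points hn C h2 h
  induction hk : (Finset.univ.filter fun i => C.pos i ≠ target (occ C)).card
    using Nat.strong_induction_on generalizing C with
  | _ k ih =>
  have h3 : ¬((occ C).card = 3 ∧ center (occ C) ∈ occ C) := fun h' => hl.1 h'.2
  by_cases hall : ∀ i, C.pos i = target (occ C)
  · exact .gathered C _ hall
  push Not at hall
  obtain ⟨i, hi⟩ := hall
  refine .step C i (live_of_mover h2 h3 (Or.inl hl) hi) fun active hne => ?_
  have hdark := step_light_of_collecting h h2 h3 active
  have hsub : occ (step active C) ⊆ occ C := by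
    intro x hx
    obtain ⟨j, rfl⟩ := mem_occ.1 hx
    rcases step_pos_of_collecting h2 h3 active j with h' | h'
    · rw [h']
      exact pos_mem_occ C j
    · rw [h'.2]
      exact target_mem_of_hasLeader hl
  by_cases heq : occ (step active C) = occ C
  · refine ih _ ?_ (step active C) hdark (by rwa [heq]) (by rwa [heq]) (by rwa [heq]) rfl
    rw [← hk, heq]
    exact card_off_target_lt h h2 h3 hne
  · exact H _ hdark (Finset.card_lt_card (Finset.ssubset_iff_subset_ne.2 ⟨hsub, heq⟩))

/-! ### Collecting at the centroid -/

theorem center_erase_center (P : Finset ℂ) (h : (P.erase (center P)).Nonempty) :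
    center (P.erase (center P)) = center P := by
  by_cases hc : center P ∈ P
  · apply center_eq_of_card_mul h
    have h1 := card_mul_center ⟨_, hc⟩
    rw [← Finset.add_sum_erase _ _ hc] at h1
    have h2 : ((P.erase (center P)).card : ℂ) + 1 = P.card := by
      exact_mod_cast Finset.card_erase_add_one hc
    linear_combination h1 + center P * h2
  · rw [Finset.erase_eq_of_notMem hc]

theorem center_insert_center (R : Finset ℂ) (h : center R ∉ R) :
    center (insert (center R) R) = center R := by
  apply center_eq_of_card_mul (Finset.insert_nonempty _ _)
  rw [Finset.sum_insert h, Finset.card_insert_of_notMem h]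
  rcases R.eq_empty_or_nonempty with rfl | hR
  · simp
  · rw [← card_mul_center hR]
    push_cast
    ring

/-- When a single nearest point is replaced by the centroid, then the old centroid becomes the
only point nearest to the new one. -/
theorem hasLeader_of_replace {R : Finset ℂ} {c z : ℂ} (hcen : center R = c) (hc : c ∉ R)
    (hz : z ∈ R) (hmin : ∀ q ∈ R, ‖z - c‖ ≤ ‖q - c‖) (hcard : 3 ≤ R.card)
    (hc' : center (insert c (R.erase z)) ∉ insert c (R.erase z)) :
    HasLeader (insert c (R.erase z)) := by
  set P := insert c (R.erase z) with hP
  have hcP : c ∉ R.erase z := fun h => hc (Finset.mem_of_mem_erase h)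
  have hPcard : P.card = R.card := by
    rw [hP, Finset.card_insert_of_notMem hcP, Finset.card_erase_add_one hz]
  have hk : (3 : ℝ) ≤ R.card := by exact_mod_cast hcard
  have hk0 : (R.card : ℂ) ≠ 0 := by
    have : R.card ≠ 0 := by omega
    exact_mod_cast this
  have hshift : center P - c = (c - z) / R.card := by
    have h1 : (R.card : ℂ) * c = ∑ p ∈ R, p := hcen ▸ card_mul_center ⟨z, hz⟩
    have h2 : (R.card : ℂ) * center P = ∑ p ∈ P, p :=
      hPcard ▸ card_mul_center (Finset.insert_nonempty _ _)
    rw [hP, Finset.sum_insert hcP, ← hP] at h2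
    rw [← Finset.add_sum_erase _ _ hz] at h1
    field_simp
    linear_combination h2 - h1
  have hs : 0 < ‖z - c‖ := norm_pos_iff.2 (sub_ne_zero.2 fun h => hc (h ▸ hz))
  have hnear : ‖c - center P‖ = ‖z - c‖ / R.card := by
    rw [norm_sub_rev, hshift, norm_div, norm_sub_rev c z, Complex.norm_natCast]
  -- With `r = ‖z - c‖`, the old centroid is within `r / 3` of the new one, and every other point is
  -- at least `2 * r / 3` away.
  have hthird : ‖z - c‖ / R.card ≤ ‖z - c‖ / 3 := by gcongr
  have hfar : ∀ q ∈ P, q ≠ c → ‖c - center P‖ < ‖q - center P‖ := by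
    intro q hq hqc
    have hqR : q ∈ R := Finset.mem_of_mem_erase ((Finset.mem_insert.1 hq).resolve_left hqc)
    have h1 := hmin q hqR
    have h2 := norm_sub_le_norm_sub_add_norm_sub q (center P) c
    rw [norm_sub_rev (center P) c] at h2
    linarith
  have hcmem : c ∈ P := Finset.mem_insert_self _ _
  refine ⟨hc', Finset.card_eq_one.2 ⟨c, ?_⟩⟩
  ext q
  simp only [innerRing, Finset.mem_filter, Finset.mem_singleton]
  constructor
  · rintro ⟨hq, -, hle⟩
    by_contra hqc
    exact absurd (hle c hcmem fun h => hc' (h ▸ hcmem)) (not_le.2 (hfar q hq hqc))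
  · intro hqc
    rw [hqc]
    refine ⟨hcmem, fun h => hc' (h ▸ hcmem), fun q hq _ => ?_⟩
    by_cases hqc : q = c
    · rw [hqc]
    · exact (hfar q hq hqc).le

theorem innerRing_nonempty {P : Finset ℂ} (h : (P.erase (center P)).Nonempty) :
    (innerRing P).Nonempty := by
  obtain ⟨p, hp, hmin⟩ := Finset.exists_min_image _ (fun p => ‖p - center P‖) h
  obtain ⟨hpc, hpP⟩ := Finset.mem_erase.1 hp
  exact ⟨p, Finset.mem_filter.2 ⟨hpP, hpc, fun q hq hqc =>
    hmin q (Finset.mem_erase.2 ⟨hqc, hq⟩)⟩⟩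

/-- The robots on the inner ring move to the centroid. -/
theorem leads_of_not_hasLeader (hn : 3 ≤ n) (C : Config (Fin 2) n) (h : ∀ i, C.light i = 0)
    (hl : ¬HasLeader (occ C)) (h2 : 3 ≤ (occ C).card)
    (h3 : ¬((occ C).card = 3 ∧ center (occ C) ∈ occ C))
    (H : ∀ C' : Config (Fin 2) n, (∀ i, C'.light i = 0) →
      ((occ C').erase (center (occ C'))).card < ((occ C).erase (center (occ C))).card →
      Leads C') : Leads C := by
  induction hk : (Finset.univ.filter fun i => C.pos i ≠ target (occ C)).card
    using Nat.strong_induction_on generalizing C with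
  | _ k ih =>
  have h2' : (occ C).card ≠ 2 := by omega
  have ht : target (occ C) = center (occ C) := if_neg hl
  set c := center (occ C) with hcdef
  set R := (occ C).erase c with hR
  have hRcard : 3 ≤ R.card := by
    by_cases hc : c ∈ occ C
    · rw [hR, Finset.card_erase_of_mem hc]
      have : (occ C).card ≠ 3 := fun he => h3 ⟨he, hc⟩
      omega
    · rwa [hR, Finset.erase_eq_of_notMem hc]
  have hRne : R.Nonempty := Finset.card_pos.1 (by omega)
  have hcR : c ∉ R := Finset.notMem_erase _ _
  have hcenR : center R = c := center_erase_center (occ C) hRne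
  obtain ⟨p, hp⟩ := innerRing_nonempty hRne
  obtain ⟨i, hi⟩ := mem_occ.1 (Finset.mem_filter.1 hp).1
  refine .step C i (live_of_mover h2' h3 (Or.inr (hi ▸ hp)) ?_) fun active hne => ?_
  · rw [ht, hi]
    exact (Finset.mem_filter.1 hp).2.1
  have hdark := step_light_of_collecting h h2' h3 active
  have hlt := card_off_target_lt h h2' h3 hne
  obtain ⟨i₀, -, hi₀⟩ := exists_collected h h2' h3 hne
  have hpos := step_pos_of_collecting h2' h3 active
  rw [ht] at hi₀ hpos hlt hk
  set P' := occ (step active C) with hP'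
  have hcP' : c ∈ P' := mem_occ.2 ⟨i₀, hi₀⟩
  have hV : ∀ z ∈ R, z ∉ P' → ∀ q ∈ R, ‖z - c‖ ≤ ‖q - c‖ := by
    intro z hz hzP' q hq
    obtain ⟨hzc, hzP⟩ := Finset.mem_erase.1 hz
    obtain ⟨hqc, hqP⟩ := Finset.mem_erase.1 hq
    obtain ⟨j, rfl⟩ := mem_occ.1 hzP
    rcases hpos j with h' | h'
    · exact absurd (mem_occ.2 ⟨j, h'⟩) hzP'
    · exact (Finset.mem_filter.1 (h'.1.resolve_left hl)).2.2 q hqP hqc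
  -- `R \ P'` is the set of emptied points, whose cardinality governs the case split.
  have hP'eq : P' = insert c (R \ (R \ P')) := by
    ext x
    simp only [Finset.mem_insert, Finset.mem_sdiff, not_and, not_not]
    constructor
    · intro hx
      by_cases hxc : x = c
      · exact Or.inl hxc
      · refine Or.inr ⟨?_, fun _ => hx⟩
        obtain ⟨j, rfl⟩ := mem_occ.1 hx
        rcases hpos j with h' | h'
        · rw [h'] at hxc ⊢
          exact Finset.mem_erase.2 ⟨hxc, pos_mem_occ C j⟩
        · exact absurd h'.2 hxc
    · rintro (rfl | ⟨hx, hx'⟩)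
      exacts [hcP', hx' hx]
  have hP'card : P'.card = 1 + (R.card - (R \ P').card) := by
    rw [hP'eq, Finset.card_insert_of_notMem fun hx => hcR (Finset.mem_sdiff.1 hx).1, ← hP'eq,
      Finset.card_sdiff_of_subset Finset.sdiff_subset, add_comm]
  rcases Nat.lt_trichotomy (R \ P').card 1 with hv | hv | hv
  · rw [Nat.lt_one_iff, Finset.card_eq_zero] at hv
    rw [hv, Finset.sdiff_empty] at hP'eq
    have hcen' : center P' = c := by
      rw [hP'eq]
      have := center_insert_center R (hcenR.symm ▸ hcR)
      rwa [hcenR] at this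
    have hl' : ¬HasLeader P' := fun hx => hx.1 (hcen'.symm ▸ hcP')
    have hcard' : P'.card = R.card + 1 := by
      rw [hP'eq, Finset.card_insert_of_notMem hcR]
    have herase : P'.erase (center P') = R := by
      rw [hcen', hP'eq, Finset.erase_insert hcR]
    refine ih _ ?_ (step active C) hdark hl' (by rw [← hP']; omega)
      (fun he => by rw [← hP'] at he; omega) ?_ rfl
    · rw [← hk, ← hP', target, if_neg hl', hcen']
      exact hlt
    · rw [← hP', herase]
      exact H
  · obtain ⟨z, hz⟩ := Finset.card_eq_one.1 hv
    have hzmem : z ∈ R \ P' := by rw [hz]; exact Finset.mem_singleton_self z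
    obtain ⟨hzR, hzP'⟩ := Finset.mem_sdiff.1 hzmem
    rw [hz, Finset.sdiff_singleton_eq_erase] at hP'eq
    -- `P'` has as many points as `R`, so an occupied centroid already lowers the measure.
    by_cases hc' : center P' ∈ P'
    · refine H _ hdark ?_
      rw [← hP', Finset.card_erase_of_mem hc']
      omega
    · refine leads_of_hasLeader hn _ hdark ?_ fun C' hC' hlt' => H C' hC' ?_
      · rw [← hP', hP'eq]
        rw [hP'eq] at hc'
        exact hasLeader_of_replace hcenR hcR hzR (hV z hzR hzP') hRcard hc'
      · have := Finset.card_erase_le (a := center (occ C')) (s := occ C')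
        rw [← hP'] at hlt'
        omega
  · refine H _ hdark ?_
    have := Finset.card_erase_le (a := center P') (s := P')
    rw [← hP']
    omega

/-- Points off the centroid are counted because filling an empty centroid adds an occupied point but
none off it. With a leader the centroid is empty, so plain cardinality suffices there. -/
theorem leads_of_dark (hn : 3 ≤ n) (C : Config (Fin 2) n) (h : ∀ i, C.light i = 0) :
    Leads C := by
  induction hk : ((occ C).erase (center (occ C))).card using Nat.strong_induction_on
    generalizing C with
  | _ k ih =>
  subst hk
  by_cases h1 : (occ C).card ≤ 1
  · exact .gathered C (C.pos ⟨0, by omega⟩) fun i =>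
      Finset.card_le_one.1 h1 _ (pos_mem_occ C i) _ (pos_mem_occ C _)
  by_cases h2 : (occ C).card = 2
  · exact leads_of_two_points hn C h2 h
  by_cases h3 : (occ C).card = 3 ∧ center (occ C) ∈ occ C
  · exact leads_of_midpoint C h3.1 rfl h3.2 fun i _ => h i
  by_cases hl : HasLeader (occ C)
  · refine leads_of_hasLeader hn C h hl fun C' hC' hlt => ih _ ?_ C' hC' rfl
    rw [Finset.erase_eq_of_notMem hl.1]
    exact (Finset.card_erase_le).trans_lt hlt
  · exact leads_of_not_hasLeader hn C h hl (by omega) h3 fun C' hC' hlt => ih _ hlt C' hC' rfl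

end LuminousRobots

theorem theorem7 :
    ∃ (c₀ : Fin 2) (alg : LuminousRobots.Algorithm (Fin 2)),
      ∀ (n : ℕ), 3 ≤ n →
      ∀ (frame : Fin n → LuminousRobots.Frame), LuminousRobots.AgreeOnChirality frame →
      ∀ (sched : ℕ → Finset (Fin n)), LuminousRobots.Fair sched →
      ∀ (p₀ : Fin n → ℂ),
        LuminousRobots.Gathers
          (LuminousRobots.execution alg frame sched ⟨fun _ => c₀, p₀⟩) :=
  ⟨0, LuminousRobots.gatherAlg, fun _ hn frame _ _ hfair p₀ =>
    LuminousRobots.gathers_of_leads frame hfair _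
      (LuminousRobots.leads_of_dark hn ⟨fun _ => 0, p₀⟩ fun _ => rfl) 0 rfl⟩
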